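/- Let $k$ be a field of characteristic $0$, let $n\in\mathbb Z$, and let $L$ be a formal moduli problem over $k$, presented by an $L_\infty$ algebra $\mathfrak l=\mathbb T_o[-1]L$ that is finite dimensional as a vector space. The $L_\infty$ structure is given by its cohomological vector field $Q_{\mathfrak l}$: a derivation of cohomological degree $1$ of $\mathcal O(L)=\widehat{\mathrm{Sym}}{}^\bullet(\mathfrak l^*[-1])$ with vanishing constant term and $Q_{\mathfrak l}^2=0$. Let $x_i$ be the linear coordinates on $\mathfrak l[1]$ dual to a homogeneous basis. The $(n-1)$-shifted polyvector fields on $L$ form the graded commutative algebra $$\Gamma(L,\widehat{\mathrm{Sym}}{}^\bullet(\mathbb T_L[-n]))=\widehat{\mathrm{Sym}}{}^\bullet(\mathfrak l^*[-1]\oplus\mathfrak l[1-n])=\mathcal O(T^*[n]L)$$ of power series in the $x_i$ and in the symbols $p_i=\partial/\partial x_i$ of degree $n-|x_i|$, with the Schouten bracket $[\cdot,\cdot]$ of degree $-n$; a vector field $\sum_i X^i\,\partial/\partial x_i$ on $L$ is identified with $\sum_i X^i p_i$. Let $Q_{T^*[n]L}$ be the cohomological vector field of the $L_\infty$ algebra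 $\mathbb T_o[-1](T^*[n]L)=\mathfrak l\ltimes\mathfrak l^*[n-2]$, that is, the derivation of $\mathcal O(T^*[n]L)$ which acts on $\mathcal O(L)$ by $Q_{\mathfrak l}$ and on sections of $\mathbb T_L$ by $\mathcal L_{Q_{\mathfrak l}}=[Q_{\mathfrak l},\cdot]$. For a function $F$ on $T^*[n]L$ let $Q_F$ be its Hamiltonian vector field for the canonical $n$-shifted symplectic structure on $T^*[n]L$. Let $\bar\Pi=\{\Pi_j\}_{j\ge 2}\in\prod_{j\ge2}\Gamma(L,\mathrm{Sym}^j(\mathbb T_L[-n]))$ be a polyvector field of cohomological degree $n+1$. Then the degree $1$ vector field $Q_{T^*[n]L}+Q_{\bar\Pi}$ on $T^*[n]L$ satisfies $(Q_{T^*[n]L}+Q_{\bar\Pi})^2=0$ if and only if $\bar\Pi$ is an $(n-1)$-shifted homotopy Poisson structure on $L$, i.e. $$[Q_{\mathfrak l}+\bar\Pi,\;Q_{\mathfrak l}+\bar\Pi]=0 .$$ In that case $Q_{T^*[n]L}+Q_{\bar\Pi}$ is the cohomological vector field (of degree $1$, with vanishing constant term and square zero) of an $L_\infty$ algebra structure on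 the graded vector space $\mathfrak l\oplus\mathfrak l^*[n-2]$, hence defines a formal moduli problem $T^*_{\bar\Pi}[n]L$, the twisted cotangent bundle or higher Poisson centre of $(L,\bar\Pi)$. This vector field is symplectic for the canonical $n$-shifted symplectic structure (it is a derivation of the Poisson bracket), and the zero section is a map $\sigma_0:L\to T^*_{\bar\Pi}[n]L$ of formal moduli problems: restriction of functions along it intertwines $Q_{T^*[n]L}+Q_{\bar\Pi}$ with $Q_{\mathfrak l}$. -/

import Mathlib

/-!
Formal moduli problems over a field `k` of characteristic zero are described by their
`(-1)`-shifted tangent `L∞` algebra `𝔤`, finite dimensional as a vector space.  The graded vector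
space `𝔤` is given by a finite index set `σ` of a homogeneous basis `e_s` and the function
`deg : σ → ℤ` of the cohomological degrees of the `e_s`.
-/

namespace FormalModuli

section Functions

variable (k : Type*) [Field k] {σ : Type*} (deg : σ → ℤ)

/-- The degree of the linear coordinate `x_s ∈ 𝔤^*[-1]` dual to `e_s`. -/
def coordDeg (s : σ) : ℤ := 1 - deg s

/-- The degree of the monomial `x_{s₁} ⋯ x_{sₘ}`. -/
def wordDeg (w : List σ) : ℤ := (w.map (coordDeg deg)).sum

/-- The graded vector space underlying `𝒪(X) = ∏ₘ Symᵐ(𝔤^*[-1])`.  A formal power series `f` in the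
graded commuting variables `x_s` is recorded by all its Taylor coefficients
`f [s₁, …, sₘ] = (∂_{sₘ} ⋯ ∂_{s₁} f)(0)` (left derivatives), that is, by the sequence of graded
symmetric `m`-linear forms on `𝔤[1]`, evaluated on basis vectors. -/
def Functions : Submodule k (List σ → k) where
  carrier := {f | ∀ (u v : List σ) (a b : σ),
    f (u ++ a :: b :: v) = (-1) ^ (coordDeg deg a * coordDeg deg b) * f (u ++ b :: a :: v)}
  add_mem' := by
    intro f g hf hg u v a b
    simp only [Pi.add_apply, hf u v a b, hg u v a b, mul_add]
  zero_mem' := by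
    intro u v a b
    simp
  smul_mem' := by
    intro c f hf u v a b
    simp only [Pi.smul_apply, smul_eq_mul, hf u v a b]
    ring

/-- `f` is homogeneous of cohomological degree `m`. -/
def IsHomogeneous (f : Functions k deg) (m : ℤ) : Prop :=
  ∀ w : List σ, f.1 w ≠ 0 → wordDeg deg w = m

/-- The product of two power series in terms of Taylor coefficients; the recursion is the graded
Leibniz rule `∂_s (f g) = (∂_s f) g + (-1)^{|x_s| |f|} f (∂_s g)`. -/
def mulWord : List σ → (List σ → k) → (List σ → k) → k
  | [], f, g => f [] * g []
  | s :: w, f, g =>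
      mulWord w (fun u => f (s :: u)) g +
        mulWord w (fun u => (-1) ^ (coordDeg deg s * wordDeg deg u) * f u) (fun u => g (s :: u))

variable {k}

theorem wordDeg_swap (u v : List σ) (a b : σ) :
    wordDeg deg (u ++ a :: b :: v) = wordDeg deg (u ++ b :: a :: v) := by
  simp only [wordDeg, List.map_append, List.map_cons, List.sum_append, List.sum_cons]
  ring

theorem mulWord_smul_left (c : k) (w : List σ) (f g : List σ → k) :
    mulWord k deg w (fun u => c * f u) g = c * mulWord k deg w f g := by
  induction w generalizing f g with
  | nil => simp only [mulWord]; ring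
  | cons s w ih =>
    have h : (fun u => (-1 : k) ^ (coordDeg deg s * wordDeg deg u) * (c * f u)) =
        fun u => c * ((-1 : k) ^ (coordDeg deg s * wordDeg deg u) * f u) := by
      funext u; ring
    simp only [mulWord]
    rw [h, ih, ih]
    ring

theorem mulWord_smul_right (c : k) (w : List σ) (f g : List σ → k) :
    mulWord k deg w f (fun u => c * g u) = c * mulWord k deg w f g := by
  induction w generalizing f g with
  | nil => simp only [mulWord]; ring
  | cons s w ih =>
    simp only [mulWord]
    rw [ih, ih]
    ring

theorem cons_mem {f : List σ → k} (hf : f ∈ Functions k deg) (s : σ) :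
    (fun u => f (s :: u)) ∈ Functions k deg := by
  intro u v a b
  exact hf (s :: u) v a b

theorem twist_mem {f : List σ → k} (hf : f ∈ Functions k deg) (m : ℤ) :
    (fun u => (-1) ^ (m * wordDeg deg u) * f u) ∈ Functions k deg := by
  intro u v a b
  simp only
  rw [hf u v a b, wordDeg_swap]
  ring

theorem mul_mem {f g : List σ → k} (hf : f ∈ Functions k deg) (hg : g ∈ Functions k deg) :
    (fun w => mulWord k deg w f g) ∈ Functions k deg := by
  intro u v a b
  induction u generalizing f g with
  | nil =>
    have sq : ∀ m : ℤ, ((-1 : k) ^ m) * (-1) ^ m = 1 := by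
      intro m
      rw [← mul_zpow]; simp
    have h1 : (fun u => f (a :: b :: u)) =
        fun u => (-1 : k) ^ (coordDeg deg a * coordDeg deg b) * f (b :: a :: u) := by
      funext u; exact hf [] u a b
    have h2 : (fun u => g (a :: b :: u)) =
        fun u => (-1 : k) ^ (coordDeg deg a * coordDeg deg b) * g (b :: a :: u) := by
      funext u; exact hg [] u a b
    have h3 : ∀ (s t : σ), (fun u => (-1 : k) ^ (coordDeg deg s * wordDeg deg (t :: u)) *
        f (t :: u)) = fun u => (-1 : k) ^ (coordDeg deg s * coordDeg deg t) *
          ((-1 : k) ^ (coordDeg deg s * wordDeg deg u) * f (t :: u)) := by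
      intro s t
      funext u
      have : wordDeg deg (t :: u) = coordDeg deg t + wordDeg deg u := by simp [wordDeg]
      rw [this, mul_add, zpow_add₀ (by norm_num)]
      ring
    have h4 : (fun u => (-1 : k) ^ (coordDeg deg b * wordDeg deg u) *
          ((-1 : k) ^ (coordDeg deg a * wordDeg deg u) * f u)) =
        (fun u => (-1 : k) ^ (coordDeg deg a * wordDeg deg u) *
          ((-1 : k) ^ (coordDeg deg b * wordDeg deg u) * f u)) := by
      funext u; ring
    simp only [List.nil_append, mulWord]
    rw [h1, h2, h3 a b, h3 b a, h4]
    simp only [mulWord_smul_left, mulWord_smul_right]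
    rw [mul_comm (coordDeg deg b) (coordDeg deg a)]
    have e := sq (coordDeg deg a * coordDeg deg b)
    linear_combination (- mulWord k deg v
      (fun u => (-1 : k) ^ (coordDeg deg b * wordDeg deg u) * f (a :: u))
      (fun u => g (b :: u))) * e
  | cons s u ih =>
    simp only [List.cons_append, mulWord]
    have h1 := ih (cons_mem deg hf s) hg
    have h2 := ih (twist_mem deg hf (coordDeg deg s)) (cons_mem deg hg s)
    simp only at h1 h2
    rw [h1, h2]
    ring

/-- The graded commutative product of `𝒪(X)`. -/
instance : Mul (Functions k deg) :=
  ⟨fun f g => ⟨fun w => mulWord k deg w f.1 g.1, mul_mem deg f.2 g.2⟩⟩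

/-- The constant function `1`. -/
def one [DecidableEq σ] : Functions k deg :=
  ⟨fun w => if w = [] then 1 else 0, by intro u v a b; simp⟩

/-- The coordinate function `x_s`. -/
def coord [DecidableEq σ] (s : σ) : Functions k deg :=
  ⟨fun w => if w = [s] then 1 else 0, by
    intro u v a b
    have h : ∀ c d : σ, u ++ c :: d :: v ≠ [s] := by
      intro c d h
      have := congrArg List.length h
      simp only [List.length_append, List.length_cons, List.length_nil] at this
      omega
    simp [h]⟩

/-- The left derivative `∂f/∂x_s`. -/
def lderiv (s : σ) (f : Functions k deg) : Functions k deg :=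
  ⟨fun w => f.1 (s :: w), cons_mem deg f.2 s⟩

/-- The right derivative of `f` by `x_s`, which on homogeneous `f` is
`(-1)^{|x_s| (|f| + 1)} ∂f/∂x_s`. -/
def rderiv (s : σ) (f : Functions k deg) : Functions k deg :=
  ⟨fun w => f.1 (w ++ [s]), by
    intro u v a b
    simpa using f.2 u (v ++ [s]) a b⟩

end Functions

section VectorFields

variable (k : Type*) [Field k] {σ : Type*} (deg : σ → ℤ)

/-- `Γ(X, T_X) = 𝒪(X) ⊗ 𝔤[1]`: the vector field `∑_s X^s ∂/∂x_s` is the family of its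
components `X^s`. -/
abbrev VectorField := σ → Functions k deg

variable {k}

/-- `X` has cohomological degree `m` as a derivation of `𝒪(X)`. -/
def VectorField.HasDegree (X : VectorField k deg) (m : ℤ) : Prop :=
  ∀ s, IsHomogeneous k deg (X s) (coordDeg deg s + m)

/-- The action `X(f) = ∑_s X^s ∂f/∂x_s` of vector fields on functions. -/
def VectorField.apply [Fintype σ] (X : VectorField k deg) (f : Functions k deg) :
    Functions k deg :=
  ∑ s, X s * lderiv deg s f

/-- `X² = 0` as an endomorphism of `𝒪(X)`. -/
def VectorField.SquareZero [Fintype σ] (X : VectorField k deg) : Prop :=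
  ∀ f : Functions k deg, X.apply deg (X.apply deg f) = 0

/-- The coordinate vector field `∂/∂x_s`, of degree `-|x_s|`. -/
def coordField [DecidableEq σ] (s : σ) : VectorField k deg :=
  fun t => if t = s then one deg else 0

/-- The graded commutator `[X, Y] = X Y - (-1)^{|X| |Y|} Y X` of vector fields of degrees `m`
and `m'`. -/
def lieBracket [Fintype σ] (m m' : ℤ) (X Y : VectorField k deg) : VectorField k deg :=
  fun s => X.apply deg (Y s) - (-1 : k) ^ (m * m') • Y.apply deg (X s)

variable (k)

/-- An `L∞` algebra structure on the graded vector space `𝔤` with homogeneous basis of degrees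
`deg` (equivalently, a formal moduli problem with shifted tangent complex `𝔤`), given by its
cohomological vector field.  The Taylor coefficients of `Q` of order `m` are the structure constants
of the bracket `l_m`; there is no curvature `l_0`; and `Q² = 0` is the system of generalized Jacobi
identities. -/
structure LInftyAlgebra [Fintype σ] where
  /-- the cohomological vector field `Q_𝔤` -/
  Q : VectorField k deg
  hasDegree : Q.HasDegree deg 1
  noCurvature : ∀ s, (Q s).1 [] = 0
  squareZero : Q.SquareZero deg

end VectorFields

section Cotangent

variable {k : Type*} [Field k] {ι : Type*} (n : ℤ) (deg : ι → ℤ)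

/-- The degrees of the basis `e_i`, `e^i` of `𝔩 ⊕ 𝔩^*[n-2]`, the shifted tangent complex of
`T^*[n]L`.  The coordinate `x_i` dual to `e_i` is indexed by `Sum.inl i`.  The coordinate dual to
`e^i` is indexed by `Sum.inr i`; it has degree `n - |x_i|` and is written `p_i`. -/
def cotangentDeg : ι ⊕ ι → ℤ := Sum.elim deg (fun i => 2 - n - deg i)

variable (k) in
/-- `𝒪(T^*[n]L)`, as a graded algebra, is the algebra `Γ(L, Sym^(T_L[-n]))` of `(n-1)`-shifted
polyvector fields on `L`: power series in the `x_i` and in the symbols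
`p_i = ∂/∂x_i ∈ Γ(L, T_L[-n])`. -/
abbrev PolyVector := Functions k (cotangentDeg n deg)

/-- `F` has components only in `Sym^j(T_L[-n])` with `j ≥ r`. -/
def MixedDegreeGE (F : PolyVector k n deg) (r : ℕ) : Prop :=
  ∀ w : List (ι ⊕ ι), F.1 w ≠ 0 → r ≤ w.countP Sum.isRight

/-- Pullback of functions along the projection `T^*[n]L → L`. -/
def pullback (f : Functions k deg) : PolyVector k n deg :=
  ⟨fun w => if w.all Sum.isLeft then f.1 (w.filterMap Sum.getLeft?) else 0, by
    intro u v a b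
    rcases a with a | a <;> rcases b with b | b
    · simp only [List.all_append, List.all_cons, Sum.isLeft_inl, Bool.true_and,
        List.filterMap_append, List.filterMap_cons, Sum.getLeft?_inl]
      split_ifs
      · exact f.2 _ _ a b
      · simp
    all_goals simp⟩

/-- Restriction of functions on `T^*[n]L` along the zero section `σ₀ : L → T^*[n]L`. -/
def zeroSection (F : PolyVector k n deg) : Functions k deg :=
  ⟨fun w => F.1 (w.map Sum.inl), by
    intro u v a b
    simpa [coordDeg, cotangentDeg] using F.2 (u.map Sum.inl) (v.map Sum.inl) (Sum.inl a) (Sum.inl b)⟩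

variable [Fintype ι] [DecidableEq ι]

/-- The polyvector field `∑_i X^i p_i` given by a vector field `X = ∑_i X^i ∂/∂x_i` on `L`. -/
def ofVectorField (X : VectorField k deg) : PolyVector k n deg :=
  ∑ i, pullback n deg (X i) * coord (cotangentDeg n deg) (Sum.inr i)

/-- The vector field on `T^*[n]L` defining the `L∞` structure on `𝔩 ⋉ 𝔩^*[n-2]`, for `Q = Q_𝔩`.
As `T^*[n]L` is the total space of the bundle dual to `T_L[-n]`, it is the derivation of
`Γ(L, Sym^(T_L[-n]))` that acts on `𝒪(L)` by `Q` and on sections of `T_L` by the Chevalley-Eilenberg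
differential `ℒ_Q = [Q, ·]`; thus `x_i ↦ Q(x_i)` and `p_j ↦ [Q, ∂/∂x_j]`. -/
def cotangentField (Q : VectorField k deg) : VectorField k (cotangentDeg n deg) :=
  Sum.elim (fun i => pullback n deg (Q i))
    (fun j => ofVectorField n deg (lieBracket deg 1 (-coordDeg deg j) Q (coordField deg j)))

/-- The Schouten bracket of `(n-1)`-shifted polyvector fields, of cohomological degree `-n`: with
right derivatives of `F` and left derivatives of `G`,
`[F, G] = ∑_i (F ∂/∂p_i) (∂/∂x_i G) - (-1)^{(n+1)|x_i|} (F ∂/∂x_i) (∂/∂p_i G)`.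
It is the biderivation with `[X, f] = X(f)` and `[X, Y]` the commutator for vector fields `X`, `Y`
and functions `f` on `L`. -/
def schouten (F G : PolyVector k n deg) : PolyVector k n deg :=
  ∑ i, (rderiv _ (Sum.inr i) F * lderiv _ (Sum.inl i) G -
    (-1 : k) ^ ((n + 1) * coordDeg deg i) • (rderiv _ (Sum.inl i) F * lderiv _ (Sum.inr i) G))

variable (k) in
/-- The Poisson tensor inverse to the canonical constant coefficient `n`-shifted symplectic
form on `T^*[n]L`, the duality pairing of `𝔩` and `𝔩^*[n-2]`: `{p_i, x_i} = 1` and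
`{x_i, p_i} = -(-1)^{(n+1)|x_i|}`. -/
def poissonTensor : ι ⊕ ι → ι ⊕ ι → k
  | Sum.inr i, Sum.inl j => if i = j then 1 else 0
  | Sum.inl i, Sum.inr j => if i = j then -(-1) ^ ((n + 1) * coordDeg deg i) else 0
  | _, _ => 0

/-- The Hamiltonian vector field `Q_F` on `T^*[n]L`: the Poisson tensor contracted with the de Rham
differential of `F`.  It has degree `|F| - n`. -/
def hamiltonianField (F : PolyVector k n deg) : VectorField k (cotangentDeg n deg) :=
  fun t => ∑ s, poissonTensor k n deg s t • rderiv _ s F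

/-- The Poisson bracket `{F, G} = Q_F(G)` of functions on `T^*[n]L`. -/
def poissonBracket (F G : PolyVector k n deg) : PolyVector k n deg :=
  (hamiltonianField n deg F).apply _ G

/-- A degree one vector field `Q` on `T^*[n]L` is symplectic (`ℒ_Q ω = 0`), that is, it is a
derivation of the Poisson bracket. -/
def IsSymplectic (Q : VectorField k (cotangentDeg n deg)) : Prop :=
  ∀ (m : ℤ) (F G : PolyVector k n deg), IsHomogeneous k _ F m →
    Q.apply _ (poissonBracket n deg F G) =
      poissonBracket n deg (Q.apply _ F) G +
        (-1 : k) ^ (m - n) • poissonBracket n deg F (Q.apply _ G)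

/-- `P` is an `(n-1)`-shifted homotopy Poisson structure on the formal moduli problem `L`. -/
structure IsHomotopyPoisson (L : LInftyAlgebra k deg) (P : PolyVector k n deg) : Prop where
  degree : IsHomogeneous k _ P (n + 1)
  mixedDegree : MixedDegreeGE n deg P 2
  masterEquation :
    schouten n deg (ofVectorField n deg L.Q + P) (ofVectorField n deg L.Q + P) = 0

end Cotangent

end FormalModuli

/-!
The field `Q_{T^*[n]L} + Q_Π` is itself Hamiltonian, with Hamiltonian `H = Q_𝔩 + Π`. As `F ↦ Q_F`
sends the Schouten bracket to the commutator of vector fields,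
`2 (Q_H)² = [Q_H, Q_H] = Q_{[H, H]}`. This vanishes if and only if `[H, H]` is a constant, and the
constant term of `[H, H]` is zero because `Q_H` vanishes at the origin. By the Jacobi identity `Q_H`
is a derivation of the bracket. Finally, `Π` is at least quadratic in the `p_i`, so its first
derivatives vanish along the zero section, where `Q_H` therefore restricts to `Q_𝔩`.
-/

namespace FormalModuli

section Signs

variable {k : Type*} [Field k]

theorem neg_one_zpow_add (a b : ℤ) : (-1 : k) ^ (a + b) = (-1) ^ a * (-1) ^ b :=
  zpow_add₀ (neg_ne_zero.mpr one_ne_zero) a b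

theorem neg_one_zpow_mul_self (a : ℤ) : (-1 : k) ^ a * (-1) ^ a = 1 := by
  rw [← neg_one_zpow_add, (Even.add_self a).neg_one_zpow]

theorem neg_one_zpow_congr {a b : ℤ} (h : (a : ZMod 2) = b) : (-1 : k) ^ a = (-1) ^ b := by
  have even_sub : Even (a - b) := by
    rw [← ZMod.intCast_eq_zero_iff_even, Int.cast_sub, h, sub_self]
  rw [← sub_add_cancel a b, neg_one_zpow_add, even_sub.neg_one_zpow, one_mul]

end Signs

section Algebra

variable {k : Type*} [Field k] {σ : Type*} {deg : σ → ℤ}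

@[simp] theorem wordDeg_nil : wordDeg deg [] = 0 := rfl

@[simp] theorem wordDeg_cons (s : σ) (w : List σ) :
    wordDeg deg (s :: w) = coordDeg deg s + wordDeg deg w := by
  simp [wordDeg]

@[simp] theorem wordDeg_append (u v : List σ) :
    wordDeg deg (u ++ v) = wordDeg deg u + wordDeg deg v := by
  simp [wordDeg]

@[ext] theorem Functions.ext {f g : Functions k deg} (h : ∀ w, f.1 w = g.1 w) : f = g :=
  Subtype.ext (funext h)

variable (deg) in
/-- The operator `(-1)^{m |·|}`, multiplying a function of degree `d` by `(-1)^{m d}`; it is the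
Koszul sign of moving a symbol of degree `m` past a possibly inhomogeneous function. -/
def twist (m : ℤ) : Functions k deg →ₗ[k] Functions k deg where
  toFun f := ⟨fun w => (-1) ^ (m * wordDeg deg w) * f.1 w, twist_mem deg f.2 m⟩
  map_add' _ _ := Functions.ext fun _ => mul_add ..
  map_smul' _ _ := Functions.ext fun _ => mul_left_comm ..

theorem twist_congr {m m' : ℤ} (h : (m : ZMod 2) = m') (f : Functions k deg) :
    twist deg m f = twist deg m' f :=
  Functions.ext fun w => congrArg (· * f.1 w) <| neg_one_zpow_congr <| by
    rw [Int.cast_mul, h, Int.cast_mul]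

theorem twist_twist (m m' : ℤ) (f : Functions k deg) :
    twist deg m (twist deg m' f) = twist deg (m + m') f := by
  ext w
  change (-1 : k) ^ _ * ((-1) ^ _ * _) = (-1) ^ _ * _
  rw [add_mul, neg_one_zpow_add, mul_assoc]

theorem twist_twist_self (m : ℤ) (f : Functions k deg) : twist deg m (twist deg m f) = f := by
  ext w
  change (-1 : k) ^ _ * ((-1) ^ _ * f.1 w) = f.1 w
  rw [← mul_assoc, neg_one_zpow_mul_self, one_mul]

theorem lderiv_twist (m : ℤ) (s : σ) (f : Functions k deg) :
    lderiv deg s (twist deg m f) =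
      (-1 : k) ^ (m * coordDeg deg s) • twist deg m (lderiv deg s f) := by
  ext w
  change (-1 : k) ^ (m * wordDeg deg (s :: w)) * f.1 (s :: w) =
    (-1) ^ (m * coordDeg deg s) * ((-1) ^ (m * wordDeg deg w) * f.1 (s :: w))
  rw [wordDeg_cons, mul_add, neg_one_zpow_add, mul_assoc]

theorem lderiv_mul (s : σ) (f g : Functions k deg) :
    lderiv deg s (f * g) =
      lderiv deg s f * g + twist deg (coordDeg deg s) f * lderiv deg s g := rfl

/- The coefficient of `f` at `s :: w` is the coefficient of `lderiv deg s f` at `w`, so identities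
between products follow from the Leibniz rule by induction on the word. -/
instance : NonUnitalNonAssocRing (Functions k deg) where
  left_distrib f g h := by
    ext w
    induction w generalizing f g h with
    | nil => exact mul_add (f.1 []) (g.1 []) (h.1 [])
    | cons s w ih =>
      change (lderiv deg s f * (g + h)).1 w +
          (twist deg (coordDeg deg s) f * (lderiv deg s g + lderiv deg s h)).1 w =
        (lderiv deg s (f * g)).1 w + (lderiv deg s (f * h)).1 w
      rw [ih, ih, lderiv_mul, lderiv_mul]
      exact add_add_add_comm ..
  right_distrib f g h := by
    ext w
    induction w generalizing f g h with
    | nil => exact add_mul (f.1 []) (g.1 []) (h.1 [])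
    | cons s w ih =>
      change ((lderiv deg s f + lderiv deg s g) * h).1 w +
          (twist deg (coordDeg deg s) (f + g) * lderiv deg s h).1 w =
        (lderiv deg s (f * h)).1 w + (lderiv deg s (g * h)).1 w
      rw [map_add, ih, ih, lderiv_mul, lderiv_mul]
      exact add_add_add_comm ..
  zero_mul f := Functions.ext fun w => by
    have h := mulWord_smul_left deg (0 : k) w 0 f.1
    simp only [zero_mul] at h
    exact h
  mul_zero f := Functions.ext fun w => by
    have h := mulWord_smul_right deg (0 : k) w f.1 0
    simp only [zero_mul] at h
    exact h

instance : IsScalarTower k (Functions k deg) (Functions k deg) :=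
  ⟨fun c f g => Functions.ext fun w => mulWord_smul_left deg c w f.1 g.1⟩

instance : SMulCommClass k (Functions k deg) (Functions k deg) :=
  ⟨fun c f g => Functions.ext fun w => (mulWord_smul_right deg c w f.1 g.1).symm⟩

theorem twist_mul (m : ℤ) (f g : Functions k deg) :
    twist deg m (f * g) = twist deg m f * twist deg m g := by
  ext w
  induction w generalizing f g with
  | nil =>
    change (-1 : k) ^ (m * 0) * (f.1 [] * g.1 []) =
      (-1) ^ (m * 0) * f.1 [] * ((-1) ^ (m * 0) * g.1 [])
    simp only [mul_zero, zpow_zero, one_mul]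
  | cons s w ih =>
    change (lderiv deg s (twist deg m (f * g))).1 w =
      (lderiv deg s (twist deg m f * twist deg m g)).1 w
    rw [lderiv_twist, lderiv_mul, lderiv_mul, lderiv_twist, lderiv_twist, map_add, smul_mul_assoc,
      mul_smul_comm, ← smul_add, twist_twist, add_comm (coordDeg deg s), ← twist_twist]
    exact congrArg _ (congrArg₂ (· + ·) (ih _ _) (ih _ _))

instance : NonUnitalRing (Functions k deg) where
  mul_assoc f g h := by
    ext w
    induction w generalizing f g h with
    | nil => exact mul_assoc (f.1 []) (g.1 []) (h.1 [])
    | cons s w ih =>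
      change (lderiv deg s (f * g * h)).1 w = (lderiv deg s (f * (g * h))).1 w
      rw [lderiv_mul, lderiv_mul, lderiv_mul, lderiv_mul, twist_mul, add_mul, mul_add, add_assoc]
      exact congrArg₂ (· + ·) (ih _ _ _) (congrArg₂ (· + ·) (ih _ _ _) (ih _ _ _))

theorem lderiv_lderiv (s t : σ) (f : Functions k deg) :
    lderiv deg s (lderiv deg t f) =
      (-1 : k) ^ (coordDeg deg s * coordDeg deg t) • lderiv deg t (lderiv deg s f) := by
  rw [mul_comm]
  exact Functions.ext fun w => f.2 [] w t s

theorem rderiv_rderiv (s t : σ) (f : Functions k deg) :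
    rderiv deg s (rderiv deg t f) =
      (-1 : k) ^ (coordDeg deg s * coordDeg deg t) • rderiv deg t (rderiv deg s f) := by
  ext w
  change f.1 ((w ++ [s]) ++ [t]) = _ * f.1 ((w ++ [t]) ++ [s])
  simpa using f.2 w [] s t

theorem lderiv_rderiv (s t : σ) (f : Functions k deg) :
    lderiv deg s (rderiv deg t f) = rderiv deg t (lderiv deg s f) := rfl

theorem rderiv_eq_twist_lderiv (s : σ) (f : Functions k deg) :
    rderiv deg s f = twist deg (coordDeg deg s) (lderiv deg s f) := by
  ext w
  induction w generalizing f with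
  | nil =>
    change f.1 [s] = (-1 : k) ^ (coordDeg deg s * 0) * f.1 [s]
    rw [mul_zero, zpow_zero, one_mul]
  | cons t w ih =>
    change (rderiv deg s (lderiv deg t f)).1 w =
      (lderiv deg t (twist deg (coordDeg deg s) (lderiv deg s f))).1 w
    rw [ih, lderiv_lderiv, lderiv_twist, map_smul]

theorem rderiv_mul (s : σ) (f g : Functions k deg) :
    rderiv deg s (f * g) =
      f * rderiv deg s g + rderiv deg s f * twist deg (coordDeg deg s) g := by
  simp only [rderiv_eq_twist_lderiv, lderiv_mul, map_add, twist_mul, twist_twist_self]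
  exact add_comm ..

theorem lderiv_one [DecidableEq σ] (s : σ) : lderiv deg s (one deg : Functions k deg) = 0 := by
  ext w
  simp [lderiv, one]

theorem twist_one [DecidableEq σ] (m : ℤ) : twist deg m (one deg : Functions k deg) = one deg := by
  ext w
  change (-1 : k) ^ (m * wordDeg deg w) * (if w = [] then 1 else 0) = if w = [] then 1 else 0
  split_ifs with h <;> simp [h]

@[simp] protected theorem Functions.mul_one [DecidableEq σ] (f : Functions k deg) :
    f * one deg = f := by
  ext w
  induction w generalizing f with
  | nil => exact mul_one (f.1 [])
  | cons s w ih =>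
    change (lderiv deg s (f * one deg)).1 w = (lderiv deg s f).1 w
    rw [lderiv_mul, lderiv_one, mul_zero, add_zero, ih]

@[simp] protected theorem Functions.one_mul [DecidableEq σ] (f : Functions k deg) :
    one deg * f = f := by
  ext w
  induction w generalizing f with
  | nil => exact one_mul (f.1 [])
  | cons s w ih =>
    change (lderiv deg s (one deg * f)).1 w = (lderiv deg s f).1 w
    rw [lderiv_mul, lderiv_one, twist_one, zero_mul, zero_add, ih]

end Algebra

section Homogeneous

variable {k : Type*} [Field k] {σ : Type*} {deg : σ → ℤ}

variable (k deg) in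
/-- The functions of cohomological degree `m`. -/
def homogeneousSubmodule (m : ℤ) : Submodule k (Functions k deg) where
  carrier := {f | IsHomogeneous k deg f m}
  add_mem' {f g} hf hg w h := by
    by_cases hfw : f.1 w = 0
    · exact hg w fun hgw => h (by rw [Submodule.coe_add, Pi.add_apply, hfw, hgw, add_zero])
    · exact hf w hfw
  zero_mem' _ h := absurd rfl h
  smul_mem' c _ hf w h := hf w (right_ne_zero_of_mul (a := c) h)

namespace IsHomogeneous

variable {f g : Functions k deg} {m m' : ℤ}

protected theorem lderiv (hf : IsHomogeneous k deg f m) (s : σ) :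
    IsHomogeneous k deg (lderiv deg s f) (m - coordDeg deg s) := fun w h => by
  rw [← hf _ h, wordDeg_cons, add_sub_cancel_left]

protected theorem rderiv (hf : IsHomogeneous k deg f m) (s : σ) :
    IsHomogeneous k deg (rderiv deg s f) (m - coordDeg deg s) := fun w h => by
  rw [← hf _ h, wordDeg_append, wordDeg_cons, wordDeg_nil, add_zero, add_sub_cancel_right]

theorem twist_eq (hf : IsHomogeneous k deg f m) (a : ℤ) :
    twist deg a f = (-1 : k) ^ (a * m) • f := by
  ext w
  change (-1 : k) ^ (a * wordDeg deg w) * f.1 w = (-1) ^ (a * m) * f.1 w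
  by_cases h : f.1 w = 0
  · rw [h, mul_zero, mul_zero]
  · rw [hf w h]

theorem rderiv_eq (hf : IsHomogeneous k deg f m) (s : σ) :
    FormalModuli.rderiv deg s f =
      (-1 : k) ^ (coordDeg deg s * (m - coordDeg deg s)) • FormalModuli.lderiv deg s f := by
  rw [rderiv_eq_twist_lderiv, (hf.lderiv s).twist_eq]

protected theorem mul (hf : IsHomogeneous k deg f m) (hg : IsHomogeneous k deg g m') :
    IsHomogeneous k deg (f * g) (m + m') := by
  intro w h
  induction w generalizing f g m m' with
  | nil => rw [← hf [] (left_ne_zero_of_mul h), ← hg [] (right_ne_zero_of_mul h), wordDeg_nil,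
      add_zero]
  | cons s w ih =>
    rw [wordDeg_cons]
    by_cases hlead : (FormalModuli.lderiv deg s f * g).1 w = 0
    · have hrest : (twist deg (coordDeg deg s) f * FormalModuli.lderiv deg s g).1 w ≠ 0 := by
        intro hzero
        exact h ((congrArg₂ (· + ·) hlead hzero).trans (add_zero 0))
      rw [hf.twist_eq] at hrest
      rw [ih ((homogeneousSubmodule k deg m).smul_mem _ hf) (hg.lderiv s) hrest]
      ring
    · rw [ih (hf.lderiv s) hg hlead]
      ring

theorem mul_eq (hf : IsHomogeneous k deg f m) (g : Functions k deg) :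
    f * g = twist deg m g * f := by
  ext w
  induction w generalizing f g m with
  | nil =>
    change f.1 [] * g.1 [] = (-1 : k) ^ (m * 0) * g.1 [] * f.1 []
    rw [mul_zero, zpow_zero, one_mul, mul_comm]
  | cons s w ih =>
    change (FormalModuli.lderiv deg s (f * g)).1 w =
      (FormalModuli.lderiv deg s (twist deg m g * f)).1 w
    have sign : ((m - coordDeg deg s : ℤ) : ZMod 2) = (coordDeg deg s + m : ℤ) := by
      push_cast; grind
    rw [lderiv_mul, lderiv_mul, lderiv_twist, twist_twist, hf.twist_eq, smul_mul_assoc,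
      smul_mul_assoc, ← twist_congr sign, mul_comm m]
    exact (congrArg₂ (· + ·) (ih (hf.lderiv s) g) (congrArg _ (ih hf _))).trans (add_comm ..)

protected theorem mul_comm (hf : IsHomogeneous k deg f m) (hg : IsHomogeneous k deg g m') :
    f * g = (-1 : k) ^ (m * m') • (g * f) := by
  rw [hf.mul_eq, hg.twist_eq, smul_mul_assoc]

end IsHomogeneous

theorem isHomogeneous_coord [DecidableEq σ] (s : σ) :
    IsHomogeneous k deg (coord deg s) (coordDeg deg s) := fun w h => by
  rw [of_not_not fun hw : w ≠ [s] => h (if_neg hw), wordDeg_cons, wordDeg_nil, add_zero]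

theorem lderiv_coord [DecidableEq σ] (s t : σ) :
    lderiv deg s (coord deg t : Functions k deg) = if s = t then one deg else 0 := by
  ext w
  by_cases h : s = t <;> simp [lderiv, coord, one, h]

theorem rderiv_coord [DecidableEq σ] (s t : σ) :
    rderiv deg s (coord deg t : Functions k deg) = if s = t then one deg else 0 := by
  rw [rderiv_eq_twist_lderiv, lderiv_coord, apply_ite (twist deg _), twist_one, map_zero]

theorem eq_zero_of_rderiv_eq_zero {f : Functions k deg} (h : ∀ s, rderiv deg s f = 0)
    (h_nil : f.1 [] = 0) : f = 0 := by
  ext w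
  rcases List.eq_nil_or_concat' w with rfl | ⟨u, s, rfl⟩
  · exact h_nil
  · exact congrArg (fun g => g.1 u) (h s)

end Homogeneous

section Derivations

variable {k : Type*} [Field k] {σ : Type*} {deg : σ → ℤ}

theorem lderiv_sum {α : Type*} (S : Finset α) (s : σ) (f : α → Functions k deg) :
    lderiv deg s (∑ i ∈ S, f i) = ∑ i ∈ S, lderiv deg s (f i) :=
  map_sum (AddMonoidHom.mk' (lderiv deg s) fun _ _ => rfl) f S

theorem rderiv_sum {α : Type*} (S : Finset α) (s : σ) (f : α → Functions k deg) :
    rderiv deg s (∑ i ∈ S, f i) = ∑ i ∈ S, rderiv deg s (f i) :=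
  map_sum (AddMonoidHom.mk' (rderiv deg s) fun _ _ => rfl) f S

theorem lderiv_smul (s : σ) (c : k) (f : Functions k deg) :
    lderiv deg s (c • f) = c • lderiv deg s f := rfl

theorem rderiv_smul (s : σ) (c : k) (f : Functions k deg) :
    rderiv deg s (c • f) = c • rderiv deg s f := rfl

namespace VectorField

variable [Fintype σ] {X Y : VectorField k deg} {m m' : ℤ}

theorem apply_sum {α : Type*} (X : VectorField k deg) (S : Finset α) (f : α → Functions k deg) :
    X.apply deg (∑ i ∈ S, f i) = ∑ i ∈ S, X.apply deg (f i) := by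
  simp only [apply, lderiv_sum, Finset.mul_sum]
  exact Finset.sum_comm

theorem apply_smul (X : VectorField k deg) (c : k) (f : Functions k deg) :
    X.apply deg (c • f) = c • X.apply deg f := by
  simp only [apply, lderiv_smul, mul_smul_comm, Finset.smul_sum]

theorem apply_coord [DecidableEq σ] (X : VectorField k deg) (s : σ) :
    X.apply deg (coord deg s) = X s := by
  simp [apply, lderiv_coord]

theorem apply_coeff_nil (hX : ∀ s, (X s).1 [] = 0) (f : Functions k deg) :
    (X.apply deg f).1 [] = 0 := by
  rw [apply, Submodule.coe_sum, Finset.sum_apply]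
  exact Finset.sum_eq_zero fun s _ => mul_eq_zero_of_left (hX s) _

theorem HasDegree.apply_mul (hX : X.HasDegree deg m) (f g : Functions k deg) :
    X.apply deg (f * g) = X.apply deg f * g + twist deg m f * X.apply deg g := by
  have pass (s : σ) : X s * twist deg (coordDeg deg s) f = twist deg m f * X s := by
    rw [(hX s).mul_eq, twist_twist]
    congr 1
    refine twist_congr ?_ f
    push_cast
    grind
  simp only [apply, lderiv_mul, mul_add, Finset.sum_add_distrib, Finset.sum_mul, Finset.mul_sum,
    ← mul_assoc, pass]

theorem HasDegree.apply_apply (hX : X.HasDegree deg m) (Y : VectorField k deg)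
    (f : Functions k deg) :
    X.apply deg (Y.apply deg f) = ∑ t, X.apply deg (Y t) * lderiv deg t f +
      ∑ t, twist deg m (Y t) * X.apply deg (lderiv deg t f) := by
  rw [apply.eq_def deg Y f, apply_sum, ← Finset.sum_add_distrib]
  exact Finset.sum_congr rfl fun t _ => hX.apply_mul _ _

theorem HasDegree.sum_twist_mul_apply_lderiv (hX : X.HasDegree deg m) (hY : Y.HasDegree deg m')
    (f : Functions k deg) :
    ∑ t, twist deg m (Y t) * X.apply deg (lderiv deg t f) =
      (-1 : k) ^ (m * m') • ∑ s, twist deg m' (X s) * Y.apply deg (lderiv deg s f) := by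
  simp only [apply, Finset.mul_sum, Finset.smul_sum]
  rw [Finset.sum_comm]
  refine Finset.sum_congr rfl fun s _ => Finset.sum_congr rfl fun t _ => ?_
  rw [(hX s).twist_eq, (hY t).twist_eq, lderiv_lderiv]
  simp only [smul_mul_assoc, mul_smul_comm, ← mul_assoc]
  rw [(hY t).mul_comm (hX s)]
  simp only [smul_mul_assoc, smul_smul, ← neg_one_zpow_add]
  refine congrArg (· • _) (neg_one_zpow_congr ?_)
  push_cast
  grind

theorem HasDegree.lieBracket_apply (hX : X.HasDegree deg m) (hY : Y.HasDegree deg m')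
    (f : Functions k deg) :
    (lieBracket deg m m' X Y).apply deg f =
      X.apply deg (Y.apply deg f) - (-1 : k) ^ (m * m') • Y.apply deg (X.apply deg f) := by
  rw [hX.apply_apply, hY.apply_apply, hX.sum_twist_mul_apply_lderiv hY, smul_add,
    add_sub_add_right_eq_sub, apply]
  simp only [lieBracket, sub_mul, smul_mul_assoc, Finset.sum_sub_distrib, Finset.smul_sum]

theorem HasDegree.squareZero_iff_lieBracket_eq_zero [NeZero (2 : k)] (hX : X.HasDegree deg m)
    (hm : Odd m) : X.SquareZero deg ↔ lieBracket deg m m X X = 0 := by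
  classical
  have bracket_apply (f : Functions k deg) :
      (lieBracket deg m m X X).apply deg f = (2 : k) • X.apply deg (X.apply deg f) := by
    rw [hX.lieBracket_apply hX, (hm.mul hm).neg_one_zpow, neg_one_smul, sub_neg_eq_add, two_smul]
  constructor
  · intro hsq
    funext s
    rw [← apply_coord (lieBracket deg m m X X) s, bracket_apply, hsq, smul_zero, Pi.zero_apply]
  · intro hzero f
    have h := bracket_apply f
    rw [hzero, apply, Finset.sum_eq_zero fun s _ => zero_mul _] at h
    exact (smul_eq_zero.mp h.symm).resolve_left two_ne_zero

end VectorField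

end Derivations

section Poisson

variable {k : Type*} [Field k] {ι : Type*} {n : ℤ} {deg : ι → ℤ}

@[simp] theorem coordDeg_cotangentDeg_inl (i : ι) :
    coordDeg (cotangentDeg n deg) (Sum.inl i) = coordDeg deg i := rfl

@[simp] theorem coordDeg_cotangentDeg_inr (i : ι) :
    coordDeg (cotangentDeg n deg) (Sum.inr i) = n - coordDeg deg i := by
  simp only [coordDeg, cotangentDeg, Sum.elim_inr]
  ring

variable [DecidableEq ι]

theorem coordDeg_add_of_poissonTensor_ne_zero {s t : ι ⊕ ι} (h : poissonTensor k n deg s t ≠ 0) :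
    coordDeg (cotangentDeg n deg) s + coordDeg (cotangentDeg n deg) t = n := by
  rcases s with i | i <;> rcases t with j | j <;>
    simp_all [poissonTensor]

theorem intCast_coordDeg_add_of_poissonTensor_ne_zero {s t : ι ⊕ ι}
    (h : poissonTensor k n deg s t ≠ 0) :
    (coordDeg (cotangentDeg n deg) s + coordDeg (cotangentDeg n deg) t : ZMod 2) = n := by
  exact_mod_cast congrArg (Int.cast : ℤ → ZMod 2) (coordDeg_add_of_poissonTensor_ne_zero h)

theorem poissonTensor_swap (s t : ι ⊕ ι) :
    poissonTensor k n deg t s = -((-1) ^ (coordDeg (cotangentDeg n deg) s *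
      coordDeg (cotangentDeg n deg) t) * poissonTensor k n deg s t) := by
  have sign (i : ι) : (-1 : k) ^ (coordDeg deg i * (n - coordDeg deg i)) =
      (-1) ^ ((n + 1) * coordDeg deg i) := by
    apply neg_one_zpow_congr
    push_cast
    generalize (n : ZMod 2) = a, (coordDeg deg i : ZMod 2) = b
    decide +revert
  rcases s with i | i <;> rcases t with j | j
  · simp [poissonTensor]
  · by_cases h : i = j
    · subst h
      simp [poissonTensor, sign, neg_one_zpow_mul_self]
    · simp [poissonTensor, h, Ne.symm h]
  · by_cases h : i = j
    · subst h
      simp [poissonTensor, sign, mul_comm (n - coordDeg deg i)]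
    · simp [poissonTensor, h, Ne.symm h]
  · simp [poissonTensor]

variable [Fintype ι]

theorem hamiltonianField_inl (F : PolyVector k n deg) (i : ι) :
    hamiltonianField n deg F (Sum.inl i) = rderiv _ (Sum.inr i) F := by
  simp [hamiltonianField, poissonTensor]

theorem hamiltonianField_inr (F : PolyVector k n deg) (i : ι) :
    hamiltonianField n deg F (Sum.inr i) =
      -((-1 : k) ^ ((n + 1) * coordDeg deg i) • rderiv _ (Sum.inl i) F) := by
  simp [hamiltonianField, poissonTensor]

protected theorem IsHomogeneous.hamiltonianField {F : PolyVector k n deg} {m : ℤ}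
    (hF : IsHomogeneous k _ F m) : (hamiltonianField n deg F).HasDegree _ (m - n) := by
  refine fun t => (homogeneousSubmodule k _ _).sum_mem fun s _ => ?_
  by_cases h : poissonTensor k n deg s t = 0
  · rw [h, zero_smul]
    exact zero_mem _
  · have hdeg : coordDeg (cotangentDeg n deg) t + (m - n) =
        m - coordDeg (cotangentDeg n deg) s := by
      linarith [coordDeg_add_of_poissonTensor_ne_zero h]
    rw [hdeg]
    exact Submodule.smul_mem _ _ (hF.rderiv s)

theorem hamiltonianField_eq_zero_iff {F : PolyVector k n deg} :
    hamiltonianField n deg F = 0 ↔ ∀ s, rderiv _ s F = 0 := by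
  simp [funext_iff, hamiltonianField_inl, hamiltonianField_inr, zpow_ne_zero, and_comm]

theorem hamiltonianField_add (F G : PolyVector k n deg) :
    hamiltonianField n deg (F + G) = hamiltonianField n deg F + hamiltonianField n deg G := by
  funext t
  exact (Finset.sum_congr rfl fun s _ => smul_add _ (rderiv _ s F) (rderiv _ s G)).trans
    Finset.sum_add_distrib

theorem schouten_eq_poissonBracket (F G : PolyVector k n deg) :
    schouten n deg F G = poissonBracket n deg F G := by
  simp only [schouten, poissonBracket, VectorField.apply, Fintype.sum_sum_type,
    hamiltonianField_inl, hamiltonianField_inr, neg_mul, smul_mul_assoc, Finset.sum_neg_distrib,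
    Finset.sum_sub_distrib, ← sub_eq_add_neg]

theorem poissonBracket_eq_sum (F G : PolyVector k n deg) :
    poissonBracket n deg F G =
      ∑ t, ∑ s, poissonTensor k n deg s t • (rderiv _ s F * lderiv _ t G) := by
  simp only [poissonBracket, VectorField.apply, hamiltonianField, Finset.sum_mul, smul_mul_assoc]

theorem IsHomogeneous.poissonBracket_antisymm {F G : PolyVector k n deg} {m m' : ℤ}
    (hF : IsHomogeneous k _ F m) (hG : IsHomogeneous k _ G m') :
    poissonBracket n deg F G =
      -((-1 : k) ^ ((m - n) * (m' - n)) • poissonBracket n deg G F) := by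
  rw [poissonBracket_eq_sum, poissonBracket_eq_sum, Finset.sum_comm]
  simp only [Finset.smul_sum, ← Finset.sum_neg_distrib]
  refine Finset.sum_congr rfl fun s _ => Finset.sum_congr rfl fun t _ => ?_
  by_cases h : poissonTensor k n deg s t = 0
  · rw [poissonTensor_swap s t, h]
    simp
  rw [hG.rderiv_eq, hF.rderiv_eq, poissonTensor_swap s t, smul_mul_assoc, smul_mul_assoc,
    (hF.lderiv s).mul_comm (hG.lderiv t), neg_smul, smul_neg, neg_neg]
  simp only [smul_smul, ← mul_assoc, mul_comm _ (poissonTensor k n deg s t)]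
  simp only [mul_assoc, ← neg_one_zpow_add]
  refine congrArg (· • _) (congrArg _ (neg_one_zpow_congr ?_))
  push_cast
  rw [← intCast_coordDeg_add_of_poissonTensor_ne_zero h]
  generalize (coordDeg (cotangentDeg n deg) s : ZMod 2) = a,
    (coordDeg (cotangentDeg n deg) t : ZMod 2) = b, (m : ZMod 2) = c, (m' : ZMod 2) = d
  decide +revert

theorem IsHomogeneous.rderiv_poissonBracket {G : PolyVector k n deg} {m' : ℤ}
    (hG : IsHomogeneous k _ G m') (F : PolyVector k n deg) (r : ι ⊕ ι) :
    FormalModuli.rderiv _ r (poissonBracket n deg F G) =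
      poissonBracket n deg F (FormalModuli.rderiv _ r G) +
        (-1 : k) ^ (coordDeg (cotangentDeg n deg) r * (m' - n)) •
          poissonBracket n deg (FormalModuli.rderiv _ r F) G := by
  simp only [poissonBracket_eq_sum, rderiv_sum, rderiv_smul, Finset.smul_sum,
    ← Finset.sum_add_distrib]
  refine Finset.sum_congr rfl fun t _ => Finset.sum_congr rfl fun s _ => ?_
  rw [rderiv_mul, lderiv_rderiv, (hG.lderiv t).twist_eq, rderiv_rderiv, smul_add]
  congr 1
  by_cases h : poissonTensor k n deg s t = 0
  · simp only [h, zero_smul, smul_zero]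
  rw [smul_mul_assoc, mul_smul_comm, smul_comm _ (poissonTensor k n deg s t), smul_smul (_ ^ _),
    ← neg_one_zpow_add]
  refine congrArg (fun c => _ • c • _) (neg_one_zpow_congr ?_)
  push_cast
  rw [← intCast_coordDeg_add_of_poissonTensor_ne_zero h]
  grind

theorem apply_hamiltonianField (X : VectorField k (cotangentDeg n deg)) (F : PolyVector k n deg)
    (t : ι ⊕ ι) :
    X.apply _ (hamiltonianField n deg F t) =
      ∑ s, poissonTensor k n deg s t • X.apply _ (rderiv _ s F) := by
  simp only [hamiltonianField, VectorField.apply_sum, VectorField.apply_smul]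

theorem IsHomogeneous.hamiltonianField_poissonBracket {F G : PolyVector k n deg} {m m' : ℤ}
    (hF : IsHomogeneous k _ F m) (hG : IsHomogeneous k _ G m') :
    FormalModuli.hamiltonianField n deg (poissonBracket n deg F G) =
      lieBracket _ (m - n) (m' - n) (FormalModuli.hamiltonianField n deg F)
        (FormalModuli.hamiltonianField n deg G) := by
  have rderiv_bracket (s : ι ⊕ ι) : FormalModuli.rderiv _ s (poissonBracket n deg F G) =
      poissonBracket n deg F (FormalModuli.rderiv _ s G) -
        (-1 : k) ^ ((m - n) * (m' - n)) • poissonBracket n deg G (FormalModuli.rderiv _ s F) := by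
    rw [hG.rderiv_poissonBracket, (hF.rderiv s).poissonBracket_antisymm hG, smul_neg, smul_smul,
      ← neg_one_zpow_add, ← sub_eq_add_neg]
    refine congrArg (fun c => _ - c • _) (neg_one_zpow_congr ?_)
    push_cast
    grind
  funext t
  rw [lieBracket, apply_hamiltonianField, apply_hamiltonianField, Finset.smul_sum,
    ← Finset.sum_sub_distrib]
  refine Finset.sum_congr rfl fun s _ => ?_
  rw [rderiv_bracket, smul_sub, smul_comm (poissonTensor k n deg s t)]
  rfl

theorem IsHomogeneous.poissonBracket_jacobi {F G : PolyVector k n deg} {m m' : ℤ}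
    (hF : IsHomogeneous k _ F m) (hG : IsHomogeneous k _ G m') (K : PolyVector k n deg) :
    poissonBracket n deg F (poissonBracket n deg G K) =
      poissonBracket n deg (poissonBracket n deg F G) K +
        (-1 : k) ^ ((m - n) * (m' - n)) •
          poissonBracket n deg G (poissonBracket n deg F K) := by
  rw [poissonBracket.eq_def n deg (poissonBracket n deg F G) K,
    hF.hamiltonianField_poissonBracket hG, hF.hamiltonianField.lieBracket_apply hG.hamiltonianField]
  exact (sub_add_cancel ..).symm

theorem IsHomogeneous.isSymplectic_hamiltonianField {H : PolyVector k n deg}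
    (hH : IsHomogeneous k _ H (n + 1)) :
    IsSymplectic n deg (FormalModuli.hamiltonianField n deg H) := by
  intro m F G hF
  have h := hH.poissonBracket_jacobi hF G
  rwa [add_sub_cancel_left, one_mul] at h

theorem IsHomogeneous.squareZero_hamiltonianField_iff [NeZero (2 : k)] {H : PolyVector k n deg}
    (hH : IsHomogeneous k _ H (n + 1))
    (h_nil : ∀ s, (FormalModuli.hamiltonianField n deg H s).1 [] = 0) :
    (FormalModuli.hamiltonianField n deg H).SquareZero _ ↔ schouten n deg H H = 0 := by
  have odd : Odd (n + 1 - n) := by simp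
  rw [hH.hamiltonianField.squareZero_iff_lieBracket_eq_zero odd,
    ← hH.hamiltonianField_poissonBracket hH, hamiltonianField_eq_zero_iff,
    schouten_eq_poissonBracket]
  refine ⟨fun h => eq_zero_of_rderiv_eq_zero h (VectorField.apply_coeff_nil h_nil H), ?_⟩
  intro h s
  rw [h]
  rfl

end Poisson

section Cotangent

variable {k : Type*} [Field k] {ι : Type*} {n : ℤ} {deg : ι → ℤ}

theorem lderiv_inl_pullback (i : ι) (f : Functions k deg) :
    lderiv _ (Sum.inl i) (pullback n deg f) = pullback n deg (lderiv deg i f) := rfl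

theorem lderiv_inr_pullback (i : ι) (f : Functions k deg) :
    lderiv _ (Sum.inr i) (pullback n deg f) = 0 := by
  ext w
  simp [lderiv, pullback]

theorem pullback_smul (c : k) (f : Functions k deg) :
    pullback n deg (c • f) = c • pullback n deg f := by
  ext w
  exact (mul_ite_zero ..).symm

protected theorem IsHomogeneous.pullback {f : Functions k deg} {m : ℤ}
    (hf : IsHomogeneous k deg f m) : IsHomogeneous k _ (pullback n deg f) m := by
  intro w h
  induction w generalizing f m with
  | nil => exact hf [] h
  | cons s w ih =>
    rcases s with i | i
    · have h_lderiv : (FormalModuli.pullback n deg (FormalModuli.lderiv deg i f)).1 w ≠ 0 := by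
        rwa [← lderiv_inl_pullback]
      rw [wordDeg_cons, ih (hf.lderiv i) h_lderiv, coordDeg_cotangentDeg_inl, add_sub_cancel]
    · have h_zero : (FormalModuli.pullback n deg f).1 (Sum.inr i :: w) = 0 :=
        congrArg (fun F : PolyVector k n deg => F.1 w) (lderiv_inr_pullback i f)
      exact absurd h_zero h

theorem zeroSection_lderiv_inl (i : ι) (F : PolyVector k n deg) :
    zeroSection n deg (lderiv _ (Sum.inl i) F) = lderiv deg i (zeroSection n deg F) := rfl

theorem zeroSection_add (F G : PolyVector k n deg) :
    zeroSection n deg (F + G) = zeroSection n deg F + zeroSection n deg G := rfl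

theorem zeroSection_smul (c : k) (F : PolyVector k n deg) :
    zeroSection n deg (c • F) = c • zeroSection n deg F := rfl

theorem zeroSection_sum {α : Type*} (S : Finset α) (F : α → PolyVector k n deg) :
    zeroSection n deg (∑ i ∈ S, F i) = ∑ i ∈ S, zeroSection n deg (F i) :=
  map_sum (AddMonoidHom.mk' (zeroSection n deg) zeroSection_add) F S

theorem zeroSection_twist (m : ℤ) (F : PolyVector k n deg) :
    zeroSection n deg (twist _ m F) = twist deg m (zeroSection n deg F) := by
  ext w
  have hw : wordDeg (cotangentDeg n deg) (w.map Sum.inl) = wordDeg deg w := by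
    rw [wordDeg, List.map_map]
    rfl
  exact congrArg (fun d : ℤ => (-1 : k) ^ (m * d) * F.1 (w.map Sum.inl)) hw

theorem zeroSection_mul (F G : PolyVector k n deg) :
    zeroSection n deg (F * G) = zeroSection n deg F * zeroSection n deg G := by
  ext w
  induction w generalizing F G with
  | nil => rfl
  | cons i w ih =>
    change (zeroSection n deg (lderiv _ (Sum.inl i) (F * G))).1 w =
      (lderiv deg i (zeroSection n deg F * zeroSection n deg G)).1 w
    rw [lderiv_mul, lderiv_mul, ← zeroSection_twist, ← zeroSection_lderiv_inl,
      ← zeroSection_lderiv_inl]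
    exact congrArg₂ (· + ·) (ih _ _) (ih _ _)

theorem zeroSection_pullback (f : Functions k deg) :
    zeroSection n deg (pullback n deg f) = f := by
  ext w
  induction w generalizing f with
  | nil => rfl
  | cons i w ih =>
    change (zeroSection n deg (lderiv _ (Sum.inl i) (pullback n deg f))).1 w = (lderiv deg i f).1 w
    rw [lderiv_inl_pullback, ih]

theorem zeroSection_apply [Fintype ι] {X : VectorField k (cotangentDeg n deg)}
    {Q : VectorField k deg} (hX : ∀ t, zeroSection n deg (X t) = Sum.elim Q 0 t)
    (F : PolyVector k n deg) :
    zeroSection n deg (X.apply _ F) = Q.apply _ (zeroSection n deg F) := by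
  simp only [VectorField.apply, zeroSection_sum, zeroSection_mul, hX]
  simp [zeroSection_lderiv_inl]

theorem MixedDegreeGE.rderiv {F : PolyVector k n deg} {r : ℕ} (hF : MixedDegreeGE n deg F (r + 1))
    (s : ι ⊕ ι) : MixedDegreeGE n deg (rderiv _ s F) r := by
  intro w h
  have count_le : r + 1 ≤ (w ++ [s]).countP Sum.isRight := hF _ h
  rw [List.countP_append] at count_le
  have count_singleton : [s].countP Sum.isRight ≤ 1 := List.countP_le_length
  omega

theorem MixedDegreeGE.zeroSection_eq_zero {F : PolyVector k n deg} (hF : MixedDegreeGE n deg F 1) :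
    zeroSection n deg F = 0 := by
  ext w
  by_contra h
  have count_pos : 1 ≤ (w.map (Sum.inl : ι → ι ⊕ ι)).countP Sum.isRight := hF _ h
  simp [List.countP_map] at count_pos

variable [Fintype ι] [DecidableEq ι]

theorem MixedDegreeGE.zeroSection_hamiltonianField {F : PolyVector k n deg}
    (hF : MixedDegreeGE n deg F 2) (t : ι ⊕ ι) :
    zeroSection n deg (hamiltonianField n deg F t) = 0 := by
  rw [hamiltonianField, zeroSection_sum]
  refine Finset.sum_eq_zero fun s _ => ?_
  rw [zeroSection_smul, (hF.rderiv s).zeroSection_eq_zero, smul_zero]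

theorem VectorField.HasDegree.isHomogeneous_ofVectorField {X : VectorField k deg} {m : ℤ}
    (hX : X.HasDegree deg m) : IsHomogeneous k _ (ofVectorField n deg X) (n + m) := by
  refine (homogeneousSubmodule k _ _).sum_mem fun i _ => ?_
  have hdeg : n + m =
      coordDeg deg i + m + coordDeg (cotangentDeg n deg) (Sum.inr i) := by
    rw [coordDeg_cotangentDeg_inr]
    ring
  rw [hdeg]
  exact (hX i).pullback.mul (isHomogeneous_coord (Sum.inr i))

theorem ofVectorField_smul (c : k) (X : VectorField k deg) :
    ofVectorField n deg (c • X) = c • ofVectorField n deg X := by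
  simp only [ofVectorField, Pi.smul_apply, pullback_smul, smul_mul_assoc, Finset.smul_sum]

theorem lderiv_inl_ofVectorField (j : ι) (X : VectorField k deg) :
    lderiv _ (Sum.inl j) (ofVectorField n deg X) =
      ofVectorField n deg fun i => lderiv deg j (X i) := by
  simp [ofVectorField, lderiv_sum, lderiv_mul, lderiv_inl_pullback, lderiv_coord]

theorem rderiv_inr_ofVectorField (j : ι) (X : VectorField k deg) :
    rderiv _ (Sum.inr j) (ofVectorField n deg X) = pullback n deg (X j) := by
  simp [ofVectorField, rderiv_sum, rderiv_mul, rderiv_coord, rderiv_eq_twist_lderiv _ (pullback ..),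
    lderiv_inr_pullback]

theorem zeroSection_ofVectorField (X : VectorField k deg) :
    zeroSection n deg (ofVectorField n deg X) = 0 := by
  have zeroSection_momentum (i : ι) :
      zeroSection n deg (coord _ (Sum.inr i) : PolyVector k n deg) = 0 := by
    ext w
    simp [zeroSection, coord]
  simp [ofVectorField, zeroSection_sum, zeroSection_mul, zeroSection_momentum]

theorem lieBracket_coordField (m : ℤ) (X : VectorField k deg) (j : ι) :
    lieBracket deg m (-coordDeg deg j) X (coordField deg j) =
      (-(-1 : k) ^ (m * -coordDeg deg j)) • fun i => lderiv deg j (X i) := by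
  funext i
  have apply_coordField : X.apply deg (coordField deg j i) = 0 := by
    have lderiv_coordField (s : ι) : lderiv deg s (coordField deg j i : Functions k deg) = 0 := by
      rw [coordField, apply_ite (lderiv deg s), lderiv_one]
      exact ite_self 0
    simp [VectorField.apply, lderiv_coordField]
  have coordField_apply : (coordField deg j).apply deg (X i) = lderiv deg j (X i) := by
    simp [VectorField.apply, coordField]
  rw [lieBracket, apply_coordField, coordField_apply, zero_sub, neg_smul]
  rfl

theorem hamiltonianField_ofVectorField {Q : VectorField k deg} (hQ : Q.HasDegree deg 1) :
    hamiltonianField n deg (ofVectorField n deg Q) = cotangentField n deg Q := by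
  funext t
  rcases t with i | j
  · rw [hamiltonianField_inl, rderiv_inr_ofVectorField]
    rfl
  · rw [hamiltonianField_inr, hQ.isHomogeneous_ofVectorField.rderiv_eq, lderiv_inl_ofVectorField,
      cotangentField, Sum.elim_inr, lieBracket_coordField, ofVectorField_smul, neg_smul, smul_smul,
      ← neg_one_zpow_add]
    refine congrArg (fun c => -(c • _)) (neg_one_zpow_congr ?_)
    rw [coordDeg_cotangentDeg_inl]
    push_cast
    generalize (n : ZMod 2) = a, (coordDeg deg j : ZMod 2) = b
    decide +revert

theorem hamiltonianField_ofVectorField_add {Q : VectorField k deg} (hQ : Q.HasDegree deg 1)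
    (P : PolyVector k n deg) :
    hamiltonianField n deg (ofVectorField n deg Q + P) =
      cotangentField n deg Q + hamiltonianField n deg P := by
  rw [hamiltonianField_add, hamiltonianField_ofVectorField hQ]

theorem zeroSection_cotangentField (Q : VectorField k deg) (t : ι ⊕ ι) :
    zeroSection n deg (cotangentField n deg Q t) = Sum.elim Q 0 t := by
  rcases t with i | j
  · exact zeroSection_pullback (Q i)
  · exact zeroSection_ofVectorField _

theorem MixedDegreeGE.zeroSection_cotangentField_add_hamiltonianField {P : PolyVector k n deg}
    (hP : MixedDegreeGE n deg P 2) (Q : VectorField k deg) (t : ι ⊕ ι) :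
    zeroSection n deg ((cotangentField n deg Q + hamiltonianField n deg P) t) = Sum.elim Q 0 t := by
  rw [Pi.add_apply, zeroSection_add, hP.zeroSection_hamiltonianField, add_zero,
    zeroSection_cotangentField]

end Cotangent

section TwistedCotangent

variable {k : Type*} [Field k] {ι : Type*} [Fintype ι] [DecidableEq ι] {n : ℤ} {deg : ι → ℤ}
  {L : LInftyAlgebra k deg} {P : PolyVector k n deg}

theorem isHomogeneous_ofVectorField_add (L : LInftyAlgebra k deg)
    (hdeg : IsHomogeneous k _ P (n + 1)) :
    IsHomogeneous k _ (ofVectorField n deg L.Q + P) (n + 1) :=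
  (homogeneousSubmodule k _ _).add_mem L.hasDegree.isHomogeneous_ofVectorField hdeg

theorem cotangentField_add_hamiltonianField_coeff_nil (L : LInftyAlgebra k deg)
    (hmixed : MixedDegreeGE n deg P 2) (t : ι ⊕ ι) :
    ((cotangentField n deg L.Q + hamiltonianField n deg P) t).1 [] = 0 := by
  change (zeroSection n deg ((cotangentField n deg L.Q + hamiltonianField n deg P) t)).1 [] = 0
  rw [hmixed.zeroSection_cotangentField_add_hamiltonianField]
  rcases t with i | j
  · exact L.noCurvature i
  · rfl

theorem squareZero_cotangentField_add_hamiltonianField_iff [NeZero (2 : k)]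
    (L : LInftyAlgebra k deg) (hdeg : IsHomogeneous k _ P (n + 1))
    (hmixed : MixedDegreeGE n deg P 2) :
    (cotangentField n deg L.Q + hamiltonianField n deg P).SquareZero _ ↔
      IsHomotopyPoisson n deg L P := by
  have h_nil := cotangentField_add_hamiltonianField_coeff_nil L hmixed
  rw [← hamiltonianField_ofVectorField_add L.hasDegree] at h_nil ⊢
  rw [(isHomogeneous_ofVectorField_add L hdeg).squareZero_hamiltonianField_iff h_nil]
  exact ⟨fun h => ⟨hdeg, hmixed, h⟩, IsHomotopyPoisson.masterEquation⟩

/-- The twisted cotangent bundle `T^*_P[n]L`, or higher Poisson centre of `(L, P)`, as an `L∞`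
structure on `𝔩 ⊕ 𝔩^*[n-2]`. -/
def twistedCotangent [NeZero (2 : k)] (hP : IsHomotopyPoisson n deg L P) :
    LInftyAlgebra k (cotangentDeg n deg) where
  Q := cotangentField n deg L.Q + hamiltonianField n deg P
  hasDegree := by
    rw [← hamiltonianField_ofVectorField_add L.hasDegree, ← add_sub_cancel_left n 1]
    exact (isHomogeneous_ofVectorField_add L hP.degree).hamiltonianField
  noCurvature := cotangentField_add_hamiltonianField_coeff_nil L hP.mixedDegree
  squareZero :=
    (squareZero_cotangentField_add_hamiltonianField_iff L hP.degree hP.mixedDegree).mpr hP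

theorem isSymplectic_twistedCotangent [NeZero (2 : k)] (hP : IsHomotopyPoisson n deg L P) :
    IsSymplectic n deg (twistedCotangent hP).Q := by
  change IsSymplectic n deg (cotangentField n deg L.Q + hamiltonianField n deg P)
  rw [← hamiltonianField_ofVectorField_add L.hasDegree]
  exact (isHomogeneous_ofVectorField_add L hP.degree).isSymplectic_hamiltonianField

theorem zeroSection_twistedCotangent_apply [NeZero (2 : k)] (hP : IsHomotopyPoisson n deg L P)
    (F : PolyVector k n deg) :
    zeroSection n deg ((twistedCotangent hP).Q.apply _ F) =
      L.Q.apply _ (zeroSection n deg F) :=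
  zeroSection_apply (hP.mixedDegree.zeroSection_cotangentField_add_hamiltonianField L.Q) F

end TwistedCotangent

end FormalModuli

open FormalModuli in
theorem mainTheorem5_general {k : Type*} [Field k] [NeZero (2 : k)] {ι : Type*} [Fintype ι]
    [DecidableEq ι] (deg : ι → ℤ) (L : LInftyAlgebra k deg) (n : ℤ) (P : PolyVector k n deg)
    (hdeg : IsHomogeneous k (cotangentDeg n deg) P (n + 1)) (hmixed : MixedDegreeGE n deg P 2) :
    (VectorField.SquareZero (cotangentDeg n deg)
        (cotangentField n deg L.Q + hamiltonianField n deg P) ↔ IsHomotopyPoisson n deg L P) ∧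
    (IsHomotopyPoisson n deg L P →
      ∃ T : LInftyAlgebra k (cotangentDeg n deg),
        T.Q = cotangentField n deg L.Q + hamiltonianField n deg P ∧
        IsSymplectic n deg T.Q ∧
        ∀ F : PolyVector k n deg,
          zeroSection n deg (T.Q.apply _ F) = L.Q.apply _ (zeroSection n deg F)) :=
  ⟨squareZero_cotangentField_add_hamiltonianField_iff L hdeg hmixed, fun hP =>
    ⟨twistedCotangent hP, rfl, isSymplectic_twistedCotangent hP,
      zeroSection_twistedCotangent_apply hP⟩⟩

theorem mainTheorem5 {k : Type*} [Field k] [CharZero k] {ι : Type*} [Fintype ι] [DecidableEq ι]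
    (deg : ι → ℤ) (L : FormalModuli.LInftyAlgebra k deg) (n : ℤ)
    (P : FormalModuli.PolyVector k n deg)
    (hdeg : FormalModuli.IsHomogeneous k (FormalModuli.cotangentDeg n deg) P (n + 1))
    (hmixed : FormalModuli.MixedDegreeGE n deg P 2) :
    (FormalModuli.VectorField.SquareZero (FormalModuli.cotangentDeg n deg)
        (FormalModuli.cotangentField n deg L.Q + FormalModuli.hamiltonianField n deg P) ↔
      FormalModuli.IsHomotopyPoisson n deg L P) ∧
    (FormalModuli.IsHomotopyPoisson n deg L P →
      ∃ T : FormalModuli.LInftyAlgebra k (FormalModuli.cotangentDeg n deg),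
        T.Q = FormalModuli.cotangentField n deg L.Q + FormalModuli.hamiltonianField n deg P ∧
        FormalModuli.IsSymplectic n deg T.Q ∧
        ∀ F : FormalModuli.PolyVector k n deg,
          FormalModuli.zeroSection n deg (T.Q.apply _ F) =
            L.Q.apply _ (FormalModuli.zeroSection n deg F)) :=
  mainTheorem5_general deg L n P hdeg hmixed
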